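/- Let $G=(V,E)$ be a finite connected undirected graph without loops (parallel edges are allowed), let $q\in V$, and fix any total order on $E$. A $G$-parking function (relative to $q$) is a function $f:V\to\mathbb Z_{\ge -1}$ with $f(q)=-1$ such that every nonempty $A\subseteq V\setminus\{q\}$ contains a vertex $v$ with $0\le f(v)<d_{\overline A}(v)$, where $d_{\overline A}(v)$ is the number of edges joining $v$ to a vertex outside $A$. It is maximal if no other $G$-parking function $g$ satisfies $g(v)\ge f(v)$ for all $v\in V$. A spanning tree $T$ of $G$ is safe if, for every edge $e\notin T$, the unique cycle of $T+e$ contains an edge larger than $e$. Let $T$ be a spanning tree, and let $P_i$ be the path in $T$ from the vertex $i$ to $q$. For vertices $i\ne j$ let $m$ be the first common vertex of $P_i$ and $P_j$. Say that $i$ dominates $j$ in $T$ if $i \neq m$ and the largest edge of $P_i$ between $i$ and $m$ is larger than every edge of $P_j$ between $j$ and $m$. The orientation induced by $T$ directs every edge of $G$ from its dominating end to its dominated end. Then the map $\mu$ sending a safe spanning tree to its induced orientation is a bijection from the set of safe spanning trees of $G$ onto the set of acyclic orientations of $G$ whose unique sink is $q$. Moreover, there is a bijection $\pi$ from the set of all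 $G$-parking functions relative to $q$ to the set of all spanning trees of $G$ such that (i) a $G$-parking function $f$ is maximal if and only if $\pi(f)$ is safe; (ii) $\pi$ extends the bijection $\mu$ in the following sense: if $\pi(f)$ is safe, then $f(v)=\operatorname{outdeg}_{\mu(\pi(f))}(v)-1$ for all $v\in V$, where $\operatorname{outdeg}_{\mu(\pi(f))}(v)$ is the number of edges directed out of $v$ in the orientation $\mu(\pi(f))$. -/

import Mathlib

/-! Finite multigraphs are Mathlib's `Graph α β`, with vertex set `V(G)` and edge set `E(G)`;
`G.IsLink e x y` says that the edge `e` joins `x` and `y`. All graphs below are meant to be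
loopless; parallel edges are allowed. -/

namespace GParking

open scoped Graph

variable {α β : Type*}

/-- The adjacency structure on `V(G)` given by the edges in `S`. -/
def spanned (G : Graph α β) (S : Set β) : SimpleGraph V(G) where
  Adj u v := u ≠ v ∧ ∃ e ∈ S, G.IsLink e u v
  symm := ⟨fun _ _ h => ⟨h.1.symm, h.2.imp fun _ he => ⟨he.1, he.2.symm⟩⟩⟩
  loopless := ⟨fun _ h => h.1 rfl⟩

/-- `G` is connected (in particular it has a vertex). -/
def Connected (G : Graph α β) : Prop := (spanned G E(G)).Connected

/-- For `v ∈ A`, the number of edges of `G` from `v` to a vertex outside `A`. -/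
noncomputable def degOutside (G : Graph α β) (A : Set V(G)) (v : V(G)) : ℕ :=
  {e : β | ∃ w : V(G), w ∉ A ∧ G.IsLink e v w}.ncard

/-- `f` is a `G`-parking function relative to `q`. -/
structure IsParking (G : Graph α β) (q : V(G)) (f : V(G) → ℤ) : Prop where
  neg_one_le : ∀ v, -1 ≤ f v
  root : f q = -1
  exists_lt : ∀ A : Set V(G), A.Nonempty → q ∉ A →
    ∃ v ∈ A, 0 ≤ f v ∧ f v < degOutside G A v

/-- `f` is a maximal `G`-parking function for the pointwise order. -/
def IsMaximalParking (G : Graph α β) (q : V(G)) (f : V(G) → ℤ) : Prop :=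
  Maximal (IsParking G q) f

/-- `T` is the edge set of a spanning tree of the loopless multigraph `G`: it has no two parallel
edges, and the simple graph it forms on `V(G)` is a tree. -/
structure IsSpanningTree (G : Graph α β) (T : Set β) : Prop where
  subset : T ⊆ E(G)
  no_parallel : ∀ e ∈ T, ∀ f ∈ T, ∀ x y : α, G.IsLink e x y → G.IsLink f x y → e = f
  isTree : (spanned G T).IsTree

/-- The edges of the path between `u` and `v` in the spanning tree `T`. -/
def treePath (G : Graph α β) (T : Set β) (u v : V(G)) : Set β :=
  {e | e ∈ T ∧ ∃ p : (spanned G T).Walk u v, p.IsPath ∧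
    ∃ x y : V(G), s(x, y) ∈ p.edges ∧ G.IsLink e x y}

/-- For an edge `e` outside the spanning tree `T`, the edges of the unique cycle of `T + e`:
`e` itself and the path in `T` between the two ends of `e`. -/
def fundCycle (G : Graph α β) (T : Set β) (e : β) : Set β :=
  {f | f = e ∨ ∃ u v : V(G), G.IsLink e u v ∧ f ∈ treePath G T u v}

/-- `T` is a safe spanning tree for the given order of the edges: no edge `e` outside `T` is the
largest edge of the unique cycle of `T + e`. -/
def IsSafe [LinearOrder β] (G : Graph α β) (T : Set β) : Prop :=
  IsSpanningTree G T ∧ ∀ e ∈ E(G), e ∉ T → ∃ f ∈ fundCycle G T e, e < f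

/-- `i` dominates `j` in the spanning tree `T` rooted at `q`. Let `m` be the first common vertex of
the paths of `T` from `i` and from `j` to `q`. The path from `i` to `m` consists of the edges of
`treePath G T i q` that are not in `treePath G T j q`, and symmetrically for `j`. The
condition says that the largest edge on the path from `i` to `m` exists and is larger than all the
edges on the path from `j` to `m` (of which there may be none). -/
def Dominates [LinearOrder β] (G : Graph α β) (T : Set β) (q i j : V(G)) : Prop :=
  ∃ e ∈ treePath G T i q \ treePath G T j q,
    ∀ f ∈ treePath G T j q \ treePath G T i q, f < e

/-- An orientation of the edges of `G`: every edge `e` points from `tail e` to `head e`. -/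
structure Orientation (G : Graph α β) where
  tail : E(G) → V(G)
  head : E(G) → V(G)
  isLink : ∀ e : E(G), G.IsLink e (tail e) (head e)

namespace Orientation

variable {G : Graph α β}

/-- There is no directed cycle. -/
def Acyclic (O : Orientation G) : Prop :=
  ∀ v, ¬ Relation.TransGen (fun x y => ∃ e, O.tail e = x ∧ O.head e = y) v v

/-- `q` is a sink, and it is the only one. -/
def UniqueSink (O : Orientation G) (q : V(G)) : Prop :=
  ∀ v, (∀ e, O.tail e ≠ v) ↔ v = q

/-- The number of edges directed out of `v`. -/
noncomputable def outDegree (O : Orientation G) (v : V(G)) : ℕ :=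
  {e | O.tail e = v}.ncard

/-- `O` is induced by the spanning tree `T` rooted at `q`: every edge of `G` is directed from the
dominating end to the dominated end. -/
def InducedBy [LinearOrder β] (O : Orientation G) (T : Set β) (q : V(G)) : Prop :=
  ∀ e, Dominates G T q (O.tail e) (O.head e)

end Orientation

end GParking

/-! Encode each vertex by the edge set of its tree path to `q`. Two such paths differ exactly in
their parts before they meet, so domination is the strict colexicographic order on these finite edge
sets (`dominates_iff`). The sets are distinct and that of `q` is empty, so the induced orientation
exists and is unique, acyclic, with unique sink `q`.

Safety makes the path of `v` the colex maximum of `insert e (path of head e)` over the edges `e` out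
of `v` (`insert_le_rootPath`). This recursion recovers a safe tree from its orientation, giving
injectivity of `μ`. Run on any acyclic orientation with unique sink `q`, it builds a safe tree
inducing it (`exists_isSafe`), giving surjectivity.

The maximal parking functions are exactly the functions outdegree minus one of such orientations:
Dhar's burning process puts every parking function below one of these, and all orientations have the
same total outdegree. Since an acyclic orientation is determined by its outdegrees, safe trees and
maximal parking functions correspond bijectively.

Deletion and contraction show that there are as many parking functions as spanning trees
(`encard_parkingSet`). Both sets are finite, so the partial bijection extends to `π`. -/

namespace GParking

open scoped Graph symmDiff

/-! ### Edge sets of paths in a spanning tree -/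

section TreePaths

variable {α β : Type*} {G : Graph α β} {T : Set β} {e : β} {u v w x : V(G)}

lemma IsSpanningTree.exists_isPath (hT : IsSpanningTree G T) (u v : V(G)) :
    ∃ p : (spanned G T).Walk u v, p.IsPath :=
  (hT.isTree.existsUnique_path u v).exists

lemma IsSpanningTree.treePath_eq (hT : IsSpanningTree G T) {p : (spanned G T).Walk u v}
    (hp : p.IsPath) :
    treePath G T u v = {e | e ∈ T ∧ ∃ x y : V(G), s(x, y) ∈ p.edges ∧ G.IsLink e x y} := by
  ext e
  simp only [treePath, Set.mem_ofPred_eq]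
  refine and_congr_right fun _ => ⟨?_, fun h => ⟨p, hp, h⟩⟩
  rintro ⟨p', hp', h⟩
  rwa [(hT.isTree.existsUnique_path u v).unique hp hp']

lemma IsSpanningTree.treePath_self (hT : IsSpanningTree G T) (v : V(G)) :
    treePath G T v v = ∅ := by
  rw [hT.treePath_eq (SimpleGraph.Walk.IsPath.nil (u := v))]
  ext e
  simp

lemma treePath_subset : treePath G T u v ⊆ T := fun _ h => h.1

lemma treePath_finite (G : Graph α β) [Finite E(G)] (T : Set β) (u v : V(G)) :
    (treePath G T u v).Finite :=
  (Set.toFinite E(G)).subset fun _ ⟨_, _, _, _, _, _, h⟩ => h.edge_mem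

lemma IsSpanningTree.treePath_cons [G.Loopless] (hT : IsSpanningTree G T) (heT : e ∈ T)
    (he : G.IsLink e u x) {p : (spanned G T).Walk x v} (hp : p.IsPath) (hu : u ∉ p.support) :
    e ∉ treePath G T x v ∧ treePath G T u v = insert e (treePath G T x v) := by
  have hadj : (spanned G T).Adj u x := ⟨fun h => he.ne (congrArg Subtype.val h), e, heT, he⟩
  have hp' : (SimpleGraph.Walk.cons hadj p).IsPath := hp.cons hu
  rw [hT.treePath_eq hp, hT.treePath_eq hp']
  constructor
  · rintro ⟨-, y, z, hyz, hl⟩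
    rcases hl.eq_and_eq_or_eq_and_eq he with ⟨h1, -⟩ | ⟨-, h1⟩
    · rw [Subtype.ext h1] at hyz
      exact hu (p.fst_mem_support_of_mem_edges hyz)
    · rw [Subtype.ext h1] at hyz
      exact hu (p.snd_mem_support_of_mem_edges hyz)
  · ext f
    simp only [SimpleGraph.Walk.edges_cons, List.mem_cons, Set.mem_ofPred_eq, Set.mem_insert_iff]
    constructor
    · rintro ⟨hf, y, z, hyz | hyz, hl⟩
      · left
        rcases Sym2.eq_iff.1 hyz with ⟨rfl, rfl⟩ | ⟨rfl, rfl⟩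
        · exact hT.no_parallel f hf e heT _ _ hl he
        · exact hT.no_parallel f hf e heT _ _ hl he.symm
      · exact Or.inr ⟨hf, y, z, hyz, hl⟩
    · rintro (rfl | ⟨hf, y, z, hyz, hl⟩)
      · exact ⟨heT, u, x, Or.inl rfl, he⟩
      · exact ⟨hf, y, z, Or.inr hyz, hl⟩

/-- The paths from two adjacent vertices of the tree differ by the edge between them. -/
lemma IsSpanningTree.treePath_of_isLink [G.Loopless] (hT : IsSpanningTree G T) (heT : e ∈ T)
    (he : G.IsLink e u x) (v : V(G)) :
    (e ∉ treePath G T x v ∧ treePath G T u v = insert e (treePath G T x v)) ∨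
      (e ∉ treePath G T u v ∧ treePath G T x v = insert e (treePath G T u v)) := by
  classical
  obtain ⟨p, hp⟩ := hT.exists_isPath u v
  have hux : u ≠ x := fun h => he.ne (congrArg Subtype.val h)
  by_cases hx : x ∈ p.support
  · left
    cases p with
    | nil => simp [hux.symm] at hx
    | cons h p' =>
      rw [SimpleGraph.Walk.cons_isPath_iff] at hp
      have hx' : x ∈ p'.support := by simpa [hux.symm] using hx
      exact hT.treePath_cons heT he (hp.1.dropUntil hx')
        fun hu => hp.2 (p'.support_dropUntil_subset_support hx' hu)
  · exact Or.inr (hT.treePath_cons heT he.symm hp hx)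

lemma IsSpanningTree.exists_treePath_eq_insert [G.Loopless] (hT : IsSpanningTree G T)
    (huv : u ≠ v) : ∃ e ∈ T, ∃ w : V(G), G.IsLink e u w ∧ e ∉ treePath G T w v ∧
      treePath G T u v = insert e (treePath G T w v) := by
  obtain ⟨p, hp⟩ := hT.exists_isPath u v
  cases p with
  | nil => exact absurd rfl huv
  | cons h p' =>
    rw [SimpleGraph.Walk.cons_isPath_iff] at hp
    obtain ⟨e, heT, he⟩ := h.2
    exact ⟨e, heT, _, he, hT.treePath_cons heT he hp.1 hp.2⟩

/-- Moving one end of a path along a tree edge toggles that edge, whatever the other end is. Walking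
from `u` to `v` therefore changes both sides in the same way. -/
lemma IsSpanningTree.treePath_eq_symmDiff [G.Loopless] (hT : IsSpanningTree G T)
    (q u v : V(G)) : treePath G T u v = treePath G T u q ∆ treePath G T v q := by
  have key : ∀ {e : β} {u x : V(G)} (v : V(G)), e ∈ T → G.IsLink e u x →
      treePath G T u v = {e} ∆ treePath G T x v := by
    intro e u x v heT he
    rcases hT.treePath_of_isLink heT he v with ⟨h, h'⟩ | ⟨h, h'⟩ <;> rw [h'] <;> ext f <;>
      simp only [Set.mem_insert_iff, Set.mem_symmDiff, Set.mem_singleton_iff]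
    · by_cases hf : f = e
      · subst hf; tauto
      · tauto
    · by_cases hf : f = e
      · subst hf; tauto
      · tauto
  obtain ⟨p, -⟩ := hT.exists_isPath u v
  induction p with
  | nil => simp [hT.treePath_self]
  | cons h p ih =>
    obtain ⟨e, heT, he⟩ := h.2
    rw [key _ heT he, ih, key q heT he, symmDiff_assoc]

/-- Equal paths to `q` have empty symmetric difference, whereas the path between distinct vertices
has an edge. -/
lemma IsSpanningTree.treePath_injective [G.Loopless] (hT : IsSpanningTree G T) (q : V(G)) :
    Function.Injective fun v => treePath G T v q := by
  intro u v huv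
  by_contra hne
  obtain ⟨e, -, w, -, -, h⟩ := hT.exists_treePath_eq_insert hne
  rw [hT.treePath_eq_symmDiff q] at h
  simp only at huv
  rw [huv, symmDiff_self] at h
  exact (Set.insert_nonempty _ _).ne_empty h.symm

end TreePaths

/-! ### Spanning trees by cardinality and cuts -/

section Characterization

variable {α β : Type*} {G : Graph α β} {T : Set β}

/-- The pair of ends of an edge. -/
lemma exists_ends {e : β} (he : e ∈ E(G)) : ∃ x y : V(G), G.IsLink e x y := by
  obtain ⟨x, y, h⟩ := G.exists_isLink_of_mem_edgeSet he
  exact ⟨⟨x, h.left_mem⟩, ⟨y, h.right_mem⟩, h⟩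

/-- This compares `T` with the edges of its simple graph; injectivity of `φ` amounts to the absence
of parallel edges. -/
lemma exists_ends_map [G.Loopless] (hT : T ⊆ E(G)) :
    ∃ φ : T → (spanned G T).edgeSet, Function.Surjective φ ∧
      ∀ (e : T) (x y : V(G)), G.IsLink e.1 x y → (φ e).1 = s(x, y) := by
  choose x y hxy using fun e : T => exists_ends (hT e.2)
  have hφ : ∀ (e : T) (a b : V(G)), G.IsLink e.1 a b → s(x e, y e) = s(a, b) := by
    intro e a b h
    rcases h.eq_and_eq_or_eq_and_eq (hxy e) with ⟨h1, h2⟩ | ⟨h1, h2⟩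
    · rw [Subtype.ext h1, Subtype.ext h2]
    · rw [Subtype.ext h1, Subtype.ext h2, Sym2.eq_swap]
  refine ⟨fun e => ⟨s(x e, y e), fun h => (hxy e).ne (congrArg Subtype.val h), e.1, e.2, hxy e⟩,
    ?_, hφ⟩
  rintro ⟨z, hz⟩
  induction z with
  | h a b =>
    obtain ⟨-, e, he, hl⟩ := hz
    exact ⟨⟨e, he⟩, Subtype.ext (hφ ⟨e, he⟩ a b hl)⟩

/-- A set of edges is a spanning tree iff it has one edge less than there are vertices and
it crosses every cut. -/
lemma isSpanningTree_iff [G.Loopless] [Finite V(G)] [Finite E(G)] (q : V(G)) :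
    IsSpanningTree G T ↔ T ⊆ E(G) ∧ T.ncard + 1 = Nat.card V(G) ∧
      ∀ A : Set V(G), A.Nonempty → q ∉ A → ∃ e ∈ T, ∃ v ∈ A, ∃ w ∉ A, G.IsLink e v w := by
  constructor
  · intro hT
    obtain ⟨φ, hφs, hφ⟩ := exists_ends_map hT.subset
    have hφi : Function.Injective φ := by
      intro e f hef
      obtain ⟨x, y, h⟩ := exists_ends (hT.subset e.2)
      obtain ⟨x', y', h'⟩ := exists_ends (hT.subset f.2)
      have := congrArg Subtype.val hef
      rw [hφ e x y h, hφ f x' y' h'] at this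
      rcases Sym2.eq_iff.1 this with ⟨rfl, rfl⟩ | ⟨rfl, rfl⟩
      · exact Subtype.ext (hT.no_parallel _ e.2 _ f.2 _ _ h h')
      · exact Subtype.ext (hT.no_parallel _ e.2 _ f.2 _ _ h h'.symm)
    refine ⟨hT.subset, ?_, fun A ⟨a, ha⟩ hq => ?_⟩
    · rw [← (SimpleGraph.isTree_iff_connected_and_card.1 hT.isTree).2,
        ← Nat.card_congr (Equiv.ofBijective φ ⟨hφi, hφs⟩), Nat.card_coe_set_eq]
    · obtain ⟨p⟩ := hT.isTree.connected.preconnected a q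
      obtain ⟨d, -, hd, hd'⟩ := p.exists_boundary_dart A ha hq
      obtain ⟨-, e, he, hl⟩ := d.adj
      exact ⟨e, he, _, hd, _, hd', hl⟩
  · rintro ⟨hTE, hcard, hcut⟩
    have hTfin : Finite T := (Set.toFinite E(G)).subset hTE
    obtain ⟨φ, hφs, hφ⟩ := exists_ends_map hTE
    have hreach : ∀ v, (spanned G T).Reachable v q := by
      by_contra! h
      obtain ⟨e, he, v, hv, w, hw, hl⟩ :=
        hcut {v | ¬ (spanned G T).Reachable v q} h (fun h => h (SimpleGraph.Reachable.refl _))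
      simp only [Set.mem_ofPred_eq, not_not] at hv hw
      have hadj : (spanned G T).Adj v w := ⟨fun h => hl.ne (congrArg Subtype.val h), e, he, hl⟩
      exact hv (hadj.reachable.trans hw)
    have hconn : (spanned G T).Connected :=
      { preconnected := fun u v => (hreach u).trans (hreach v).symm
        nonempty := ⟨q⟩ }
    -- Connectivity bounds the number of simple edges below by `|V| - 1 = |T|`, and `φ` bounds it
    -- above by `|T|`. Equality gives both the tree property and the absence of parallel edges.
    have h1 := hconn.card_vert_le_card_edgeSet_add_one
    have h2 : Nat.card (spanned G T).edgeSet ≤ Nat.card T := Nat.card_le_card_of_surjective φ hφs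
    rw [← Nat.card_coe_set_eq] at hcard
    have h3 : Nat.card (spanned G T).edgeSet = Nat.card T := by omega
    have hbij : Function.Bijective φ :=
      (Nat.bijective_iff_surjective_and_card φ).2 ⟨hφs, h3.symm⟩
    refine ⟨hTE, fun e he f hf x y h h' => ?_,
      SimpleGraph.isTree_iff_connected_and_card.2 ⟨hconn, by omega⟩⟩
    have hx : x ∈ V(G) := h.left_mem
    have hy : y ∈ V(G) := h.right_mem
    have := hbij.1 (a₁ := ⟨e, he⟩) (a₂ := ⟨f, hf⟩) (Subtype.ext
      ((hφ ⟨e, he⟩ ⟨x, hx⟩ ⟨y, hy⟩ h).trans (hφ ⟨f, hf⟩ ⟨x, hx⟩ ⟨y, hy⟩ h').symm))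
    exact congrArg Subtype.val this

end Characterization

end GParking

namespace GParking

open scoped Graph symmDiff
open Finset.Colex

/-! ### Orientations and rank functions -/

namespace Orientation

variable {α β : Type*} {G : Graph α β} {O O' : Orientation G}

lemma eq_or_swap (O : Orientation G) (e : E(G)) {x y : V(G)} (h : G.IsLink e x y) :
    (O.tail e = x ∧ O.head e = y) ∨ (O.tail e = y ∧ O.head e = x) := by
  rcases (O.isLink e).eq_and_eq_or_eq_and_eq h with ⟨h1, h2⟩ | ⟨h1, h2⟩
  · exact Or.inl ⟨Subtype.ext h1, Subtype.ext h2⟩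
  · exact Or.inr ⟨Subtype.ext h1, Subtype.ext h2⟩

lemma eq_of_tail_eq (h : O.tail = O'.tail) : O = O' := by
  have h' : O.head = O'.head := by
    funext e
    have h1 := O.isLink e
    rw [h] at h1
    exact Subtype.ext (h1.right_unique (O'.isLink e))
  cases O
  cases O'
  subst h
  subst h'
  rfl

/-- An acyclic orientation is decreasing for some numbering of the vertices. -/
lemma Acyclic.exists_rank [Finite V(G)] (hO : O.Acyclic) :
    ∃ h : V(G) → ℕ, ∀ e, h (O.head e) < h (O.tail e) := by
  let R : V(G) → V(G) → Prop := fun x y => ∃ e, O.tail e = x ∧ O.head e = y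
  refine ⟨fun v => {w | Relation.TransGen R v w}.ncard, fun e => ?_⟩
  refine Set.ncard_lt_ncard ?_ (Set.toFinite _)
  have he : Relation.TransGen R (O.tail e) (O.head e) := .single ⟨e, rfl, rfl⟩
  exact ⟨fun w hw => he.trans hw, fun h => hO _ (h he)⟩

lemma acyclic_of_rank {γ : Type*} [Preorder γ] (h : V(G) → γ)
    (hh : ∀ e, h (O.head e) < h (O.tail e)) : O.Acyclic := by
  have key : ∀ v w, Relation.TransGen (fun x y => ∃ e, O.tail e = x ∧ O.head e = y) v w →
      h w < h v := by
    intro v w hvw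
    induction hvw with
    | single h =>
      obtain ⟨e, rfl, rfl⟩ := h
      exact hh e
    | tail _ h ih =>
      obtain ⟨e, rfl, rfl⟩ := h
      exact (hh e).trans ih
  exact fun v hv => lt_irrefl _ (key v v hv)

lemma UniqueSink.exists_tail_eq {q v : V(G)} (hO : O.UniqueSink q) (hv : v ≠ q) :
    ∃ e, O.tail e = v := by
  by_contra! h
  exact hv ((hO v).1 h)

lemma UniqueSink.tail_ne {q : V(G)} (hO : O.UniqueSink q) (e : E(G)) : O.tail e ≠ q :=
  (hO q).2 rfl e

end Orientation

/-! ### Root paths in colex order; injectivity of `μ` -/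

section RootPaths

variable {α β : Type*} {G : Graph α β} [Finite E(G)] {T T' : Set β}
  {q u v w : V(G)} {e : β} {O O' : Orientation G}

/-- The edges of the path of `T` from `v` to the root `q`, as a finite set. -/
noncomputable def rootPath (G : Graph α β) [Finite E(G)] (T : Set β) (q v : V(G)) : Finset β :=
  (treePath_finite G T v q).toFinset

@[simp] lemma coe_rootPath : (rootPath G T q v : Set β) = treePath G T v q :=
  Set.Finite.coe_toFinset _

@[simp] lemma mem_rootPath : e ∈ rootPath G T q v ↔ e ∈ treePath G T v q :=
  Set.Finite.mem_toFinset _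

lemma IsSpanningTree.rootPath_self (hT : IsSpanningTree G T) (q : V(G)) :
    rootPath G T q q = ∅ := by
  ext e
  simp [hT.treePath_self]

lemma IsSpanningTree.rootPath_injective [G.Loopless] (hT : IsSpanningTree G T) (q : V(G)) :
    Function.Injective (rootPath G T q) := by
  intro u v h
  apply hT.treePath_injective q
  simp only [← coe_rootPath, h]

variable [LinearOrder β]

/-- Colex order compares finite sets by the largest element of their symmetric difference, which is
the comparison made by domination. -/
lemma dominates_iff : Dominates G T q u v ↔
    toColex (rootPath G T q v) < toColex (rootPath G T q u) := by
  rw [toColex_lt_toColex_iff_exists_forall_lt]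
  simp [Dominates, and_assoc]

lemma IsSpanningTree.rootPath_of_isLink [G.Loopless] (hT : IsSpanningTree G T) (heT : e ∈ T)
    (he : G.IsLink e u w) (q : V(G)) :
    (e ∉ rootPath G T q w ∧ rootPath G T q u = insert e (rootPath G T q w)) ∨
      (e ∉ rootPath G T q u ∧ rootPath G T q w = insert e (rootPath G T q u)) := by
  simp only [← Finset.coe_inj, Finset.coe_insert, coe_rootPath, mem_rootPath]
  exact hT.treePath_of_isLink heT he q

lemma IsSpanningTree.exists_rootPath_eq_insert [G.Loopless] (hT : IsSpanningTree G T)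
    (hu : u ≠ q) : ∃ e ∈ T, ∃ w : V(G), G.IsLink e u w ∧ e ∉ rootPath G T q w ∧
      rootPath G T q u = insert e (rootPath G T q w) := by
  simp only [← Finset.coe_inj, Finset.coe_insert, coe_rootPath, mem_rootPath]
  exact hT.exists_treePath_eq_insert hu

lemma IsSpanningTree.eq_iUnion_rootPath [G.Loopless] (hT : IsSpanningTree G T) (q : V(G)) :
    T = ⋃ v, (rootPath G T q v : Set β) := by
  ext e
  simp only [Set.mem_iUnion, Finset.mem_coe]
  constructor
  · intro he
    obtain ⟨x, y, h⟩ := exists_ends (hT.subset he)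
    rcases hT.rootPath_of_isLink he h q with ⟨-, h⟩ | ⟨-, h⟩
    · exact ⟨x, h ▸ Finset.mem_insert_self _ _⟩
    · exact ⟨y, h ▸ Finset.mem_insert_self _ _⟩
  · rintro ⟨v, hv⟩
    exact treePath_subset (mem_rootPath.1 hv)

lemma IsSpanningTree.exists_inducedBy [G.Loopless] (hT : IsSpanningTree G T) (q : V(G)) :
    ∃ O : Orientation G, O.InducedBy T q := by
  have key : ∀ e : E(G), ∃ x y : V(G), G.IsLink e x y ∧ Dominates G T q x y := by
    intro e
    obtain ⟨x, y, h⟩ := exists_ends e.2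
    have hne : toColex (rootPath G T q x) ≠ toColex (rootPath G T q y) := fun h' =>
      h.ne (congrArg Subtype.val (hT.rootPath_injective q (toColex_inj.1 h')))
    rcases lt_or_gt_of_ne hne with hlt | hlt
    · exact ⟨y, x, h.symm, dominates_iff.2 hlt⟩
    · exact ⟨x, y, h, dominates_iff.2 hlt⟩
  choose x y hl hd using key
  exact ⟨⟨x, y, hl⟩, hd⟩

namespace Orientation.InducedBy

lemma rootPath_lt (hO : O.InducedBy T q) (e : E(G)) :
    toColex (rootPath G T q (O.head e)) < toColex (rootPath G T q (O.tail e)) :=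
  dominates_iff.1 (hO e)

lemma unique (hO : O.InducedBy T q) (hO' : O'.InducedBy T q) : O = O' := by
  refine eq_of_tail_eq (funext fun e => ?_)
  rcases O.eq_or_swap e (O'.isLink e) with ⟨h, -⟩ | ⟨h, h'⟩
  · exact h
  · have := hO.rootPath_lt e
    rw [h, h'] at this
    exact absurd this (hO'.rootPath_lt e).asymm

lemma acyclic (hO : O.InducedBy T q) : O.Acyclic :=
  acyclic_of_rank (fun v => toColex (rootPath G T q v)) hO.rootPath_lt

lemma uniqueSink [G.Loopless] (hT : IsSpanningTree G T) (hO : O.InducedBy T q) :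
    O.UniqueSink q := by
  intro v
  constructor
  · intro h
    by_contra hv
    obtain ⟨e, heT, w, hl, -, heq⟩ := hT.exists_rootPath_eq_insert hv
    rcases O.eq_or_swap ⟨e, hl.edge_mem⟩ hl with ⟨h1, -⟩ | ⟨h1, h2⟩
    · exact h _ h1
    · have := hO.rootPath_lt ⟨e, hl.edge_mem⟩
      rw [h1, h2, heq] at this
      exact this.not_ge (toColex_le_toColex_of_subset (Finset.subset_insert _ _))
  · rintro rfl e he
    have := hO.rootPath_lt e
    rw [he, hT.rootPath_self] at this
    exact not_lt_bot this

/-- In a safe tree, the path from `v` to the root is the largest among the paths that start with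
an edge out of `v` and go on along the tree. -/
lemma insert_le_rootPath [G.Loopless] (hT : IsSafe G T) (hO : O.InducedBy T q) (e : E(G)) :
    toColex (insert e.1 (rootPath G T q (O.head e))) ≤ toColex (rootPath G T q (O.tail e)) := by
  by_cases heT : e.1 ∈ T
  · rcases hT.1.rootPath_of_isLink heT (O.isLink e) q with ⟨-, h⟩ | ⟨-, h⟩
    · rw [h]
    · have := hO.rootPath_lt e
      rw [h] at this
      exact absurd (toColex_le_toColex_of_subset (Finset.subset_insert _ _)) this.not_ge
  · obtain ⟨f, hf, hef⟩ := hT.2 e.1 e.2 heT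
    obtain ⟨a, ⟨hat, hah⟩, ha⟩ := hO e
    have hf' : f ∈ treePath G T (O.tail e) q ∆ treePath G T (O.head e) q := by
      rcases hf with rfl | ⟨u, v, hl, hf⟩
      · exact absurd hef (lt_irrefl _)
      · rw [hT.1.treePath_eq_symmDiff q] at hf
        rcases O.eq_or_swap e hl with ⟨rfl, rfl⟩ | ⟨rfl, rfl⟩
        · exact hf
        · rwa [symmDiff_comm]
    -- `a` witnesses domination and `f` witnesses safety. If `f` lies on the tail's side, `b` is the
    -- larger of the two; otherwise `f < a` and `b = a` works.
    obtain ⟨b, hbt, hbh, hab, heb⟩ : ∃ b, b ∈ treePath G T (O.tail e) q ∧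
        b ∉ treePath G T (O.head e) q ∧ a ≤ b ∧ e.1 < b := by
      rcases hf' with ⟨h1, h2⟩ | ⟨h1, h2⟩
      · rcases le_total a f with h | h
        · exact ⟨f, h1, h2, h, hef⟩
        · exact ⟨a, hat, hah, le_rfl, hef.trans_le h⟩
      · exact ⟨a, hat, hah, le_rfl, hef.trans (ha f ⟨h1, h2⟩)⟩
    refine le_of_lt (toColex_lt_toColex_iff_exists_forall_lt.2 ⟨b, mem_rootPath.2 hbt, ?_, ?_⟩)
    · simp [hbh, heb.ne']
    · intro c hc hc'
      rcases Finset.mem_insert.1 hc with rfl | hc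
      · exact heb
      · exact (ha c ⟨mem_rootPath.1 hc, fun h => hc' (mem_rootPath.2 h)⟩).trans_le hab

lemma exists_rootPath_eq [G.Loopless] (hT : IsSpanningTree G T) (hO : O.InducedBy T q)
    (hv : v ≠ q) : ∃ e, O.tail e = v ∧
      rootPath G T q v = insert e.1 (rootPath G T q (O.head e)) := by
  obtain ⟨e, heT, w, hl, -, heq⟩ := hT.exists_rootPath_eq_insert hv
  rcases O.eq_or_swap ⟨e, hl.edge_mem⟩ hl with ⟨h1, h2⟩ | ⟨h1, h2⟩
  · exact ⟨_, h1, by rw [h2, heq]⟩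
  · have := hO.rootPath_lt ⟨e, hl.edge_mem⟩
    rw [h1, h2, heq] at this
    exact absurd (toColex_le_toColex_of_subset (Finset.subset_insert _ _)) this.not_ge

/-- A safe tree is determined by the orientation that it induces. -/
lemma eq_of_isSafe [G.Loopless] [Finite V(G)] (hT : IsSafe G T) (hT' : IsSafe G T')
    (hO : O.InducedBy T q) (hO' : O.InducedBy T' q) : T = T' := by
  obtain ⟨h, hh⟩ := hO.acyclic.exists_rank
  have key : ∀ n, ∀ v, h v = n → rootPath G T q v = rootPath G T' q v := by
    intro n
    induction n using Nat.strong_induction_on with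
    | _ n ih =>
      rintro v rfl
      by_cases hv : v = q
      · rw [hv, hT.1.rootPath_self, hT'.1.rootPath_self]
      · apply toColex_inj.1
        -- Vertices of smaller rank have the same path in both trees, so the path of `v` in either
        -- tree is one of the candidates over which the other tree's path is maximal.
        apply le_antisymm
        · obtain ⟨e, rfl, he⟩ := hO.exists_rootPath_eq hT.1 hv
          rw [he, ih _ (hh e) _ rfl]
          exact hO'.insert_le_rootPath hT' e
        · obtain ⟨e, rfl, he⟩ := hO'.exists_rootPath_eq hT'.1 hv
          rw [he, ← ih _ (hh e) _ rfl]
          exact hO.insert_le_rootPath hT e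
  rw [hT.1.eq_iUnion_rootPath q, hT'.1.eq_iUnion_rootPath q]
  exact Set.iUnion_congr fun v => by rw [key _ v rfl]

end Orientation.InducedBy

end RootPaths

/-! ### A safe tree for each orientation; surjectivity of `μ` -/

section Surjectivity

variable {α β : Type*} {G : Graph α β} {q : V(G)} {O : Orientation G}

/-- Choosing an edge out of each vertex other than the sink of an acyclic orientation yields a
spanning tree. -/
lemma Orientation.Acyclic.isSpanningTree_range [G.Loopless] [Finite V(G)] [Finite E(G)]
    (hO : O.Acyclic) (p : {v : V(G) // v ≠ q} → E(G)) (hp : ∀ v, O.tail (p v) = v) :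
    IsSpanningTree G (Set.range fun v => (p v).1) := by
  obtain ⟨h, hh⟩ := hO.exists_rank
  have hinj : Function.Injective fun v => (p v).1 := fun v w hvw =>
    Subtype.ext (by rw [← hp, ← hp, Subtype.ext hvw])
  refine (isSpanningTree_iff q).2 ⟨?_, ?_, fun A hA hq => ?_⟩
  · rintro _ ⟨v, rfl⟩
    exact (p v).2
  · classical
    have := Fintype.ofFinite V(G)
    rw [← Nat.card_coe_set_eq, Nat.card_range_of_injective hinj, Nat.card_eq_fintype_card,
      Nat.card_eq_fintype_card, Fintype.card_subtype_compl, Fintype.card_subtype_eq]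
    have : 0 < Fintype.card V(G) := Fintype.card_pos_iff.2 ⟨q⟩
    omega
  -- The edge chosen at a vertex of least rank in `A` lowers the rank, hence leaves `A`.
  · obtain ⟨v, hv, hmin⟩ := Set.exists_min_image A h (Set.toFinite A) hA
    have hvq : v ≠ q := fun h => hq (h ▸ hv)
    have hl := O.isLink (p ⟨v, hvq⟩)
    have hlt := hh (p ⟨v, hvq⟩)
    rw [hp] at hl hlt
    exact ⟨_, ⟨⟨v, hvq⟩, rfl⟩, v, hv, _, fun hw => (hmin _ hw).not_gt hlt, hl⟩

variable [LinearOrder β]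

/-- The colexicographically largest directed path from `v` to a sink. -/
noncomputable def maxPath [Fintype E(G)] (O : Orientation G) (h : V(G) → ℕ)
    (hh : ∀ e, h (O.head e) < h (O.tail e)) (v : V(G)) : Colex (Finset β) :=
  open Classical in
  (Finset.univ : Finset {e : E(G) // O.tail e = v}).sup fun e =>
    toColex (insert e.1.1 (ofColex (maxPath O h hh (O.head e.1))))
termination_by h v
decreasing_by
  have := hh e.1
  rwa [e.2] at this

/-- Every acyclic orientation with a unique sink is induced by a safe tree. -/
lemma Orientation.Acyclic.exists_isSafe [G.Loopless] [Finite V(G)] [Finite E(G)]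
    (hO : O.Acyclic) (hq : O.UniqueSink q) : ∃ T, IsSafe G T ∧ O.InducedBy T q := by
  classical
  have := Fintype.ofFinite E(G)
  obtain ⟨h, hh⟩ := hO.exists_rank
  obtain ⟨Q, hQ⟩ : ∃ Q : V(G) → Colex (Finset β), ∀ v, Q v =
      (Finset.univ : Finset {e : E(G) // O.tail e = v}).sup fun e =>
        toColex (insert e.1.1 (ofColex (Q (O.head e.1)))) :=
    ⟨maxPath O h hh, fun v => by rw [maxPath]⟩
  have hle : ∀ e : E(G), toColex (insert e.1 (ofColex (Q (O.head e)))) ≤ Q (O.tail e) := by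
    intro e
    rw [hQ (O.tail e)]
    exact Finset.le_sup (f := fun e' : {e' : E(G) // O.tail e' = O.tail e} =>
      toColex (insert e'.1.1 (ofColex (Q (O.head e'.1))))) (Finset.mem_univ ⟨e, rfl⟩)
  have hex : ∀ v : {v : V(G) // v ≠ q}, ∃ e : E(G), O.tail e = v ∧
      Q v = toColex (insert e.1 (ofColex (Q (O.head e)))) := by
    rintro ⟨v, hv⟩
    obtain ⟨e₀, he₀⟩ := hq.exists_tail_eq hv
    obtain ⟨e, -, he⟩ := Finset.exists_mem_eq_sup (Finset.univ : Finset {e : E(G) // O.tail e = v})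
      ⟨⟨e₀, he₀⟩, Finset.mem_univ _⟩ fun e => toColex (insert e.1.1 (ofColex (Q (O.head e.1))))
    exact ⟨e.1, e.2, (hQ v).trans he⟩
  choose p hp hpQ using hex
  have hT := hO.isSpanningTree_range p hp
  set T : Set β := Set.range fun v => (p v).1 with hTdef
  have hpq : ∀ v, (p v).1 ∈ T := fun v => ⟨v, rfl⟩
  -- No edge of `Q v` starts above the rank of `v`. Hence `e` is not in `Q (O.head e)`, and
  -- inserting it strictly enlarges that set.
  have hmem : ∀ n, ∀ v, h v = n → ∀ e : E(G), e.1 ∈ ofColex (Q v) → h (O.tail e) ≤ n := by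
    intro n
    induction n using Nat.strong_induction_on with
    | _ n ih =>
      rintro v rfl e he
      by_cases hv : v = q
      · subst hv
        have : IsEmpty {e : E(G) // O.tail e = v} := ⟨fun e => hq.tail_ne e.1 e.2⟩
        rw [hQ] at he
        simp at he
      · rw [hpQ ⟨v, hv⟩] at he
        have hlt := hh (p ⟨v, hv⟩)
        rw [hp] at hlt
        rcases Finset.mem_insert.1 he with he | he
        · rw [Subtype.ext he, hp]
        · exact (ih _ hlt _ rfl e he).trans hlt.le
  have hroot : ∀ n, ∀ v, h v = n → rootPath G T q v = ofColex (Q v) := by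
    intro n
    induction n using Nat.strong_induction_on with
    | _ n ih =>
      rintro v rfl
      by_cases hv : v = q
      · subst hv
        have : IsEmpty {e : E(G) // O.tail e = v} := ⟨fun e => hq.tail_ne e.1 e.2⟩
        rw [hQ, hT.rootPath_self]
        simp
      · have hlt := hh (p ⟨v, hv⟩)
        have hl := O.isLink (p ⟨v, hv⟩)
        have hlt' := hlt
        rw [hp] at hlt hl
        have hnot : (p ⟨v, hv⟩).1 ∉ rootPath G T q (O.head (p ⟨v, hv⟩)) := by
          rw [ih _ hlt _ rfl]
          exact fun hm => (hmem _ _ rfl _ hm).not_gt hlt'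
        rw [hpQ ⟨v, hv⟩, ofColex_toColex, ← ih _ hlt _ rfl]
        rcases hT.rootPath_of_isLink (hpq ⟨v, hv⟩) hl q with ⟨-, h'⟩ | ⟨-, h'⟩
        · exact h'
        · exact absurd (h' ▸ Finset.mem_insert_self _ _) hnot
  have hroot' : ∀ v, toColex (rootPath G T q v) = Q v := fun v => by
    rw [hroot _ v rfl, toColex_ofColex]
  have hind : O.InducedBy T q := by
    intro e
    rw [dominates_iff, hroot', hroot']
    refine lt_of_lt_of_le ?_ (hle e)
    exact toColex_lt_toColex_of_ssubset
      (Finset.ssubset_insert fun hm => (hmem _ _ rfl _ hm).not_gt (hh e))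
  refine ⟨T, ⟨hT, fun e he heT => ?_⟩, hind⟩
  -- Equality would put `e` on a path of `T`. The element deciding the strict comparison lies only
  -- on the tail's path and exceeds `e`, so it is the edge that safety requires.
  have hlt := (hle ⟨e, he⟩).lt_of_ne fun h' => by
    have hm : e ∈ rootPath G T q (O.tail ⟨e, he⟩) := by
      rw [hroot _ _ rfl, ← h']
      exact Finset.mem_insert_self _ _
    exact heT (treePath_subset (mem_rootPath.1 hm))
  rw [← hroot', ← hroot', toColex_lt_toColex_iff_exists_forall_lt] at hlt
  obtain ⟨a, ha, ha', hlt⟩ := hlt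
  simp only [ofColex_toColex, Finset.mem_insert, not_or, mem_rootPath] at ha ha' hlt
  refine ⟨a, Or.inr ⟨_, _, O.isLink ⟨e, he⟩, ?_⟩, hlt e (Or.inl rfl) fun h => heT h.1⟩
  rw [hT.treePath_eq_symmDiff q]
  exact Or.inl ⟨ha, ha'.2⟩

end Surjectivity

end GParking

namespace GParking

open scoped Graph

/-! ### Maximal parking functions and outdegrees -/

section Parking

variable {α β : Type*} {G : Graph α β} {q : V(G)} {O O' : Orientation G}

namespace Orientation

lemma outDegree_eq_ncard_image (O : Orientation G) (v : V(G)) :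
    O.outDegree v = (Subtype.val '' {e | O.tail e = v}).ncard :=
  (Set.ncard_image_of_injective _ Subtype.val_injective).symm

lemma sum_comp_tail [Fintype V(G)] [Fintype E(G)] (O : Orientation G) (h : V(G) → ℕ) :
    ∑ e, h (O.tail e) = ∑ v, O.outDegree v * h v := by
  classical
  rw [← Finset.sum_fiberwise Finset.univ O.tail]
  refine Finset.sum_congr rfl fun v _ => ?_
  rw [Finset.sum_congr rfl (g := fun _ => h v) (by simp +contextual), Finset.sum_const,
    smul_eq_mul, outDegree, Set.ncard_eq_toFinset_card']
  simp

/-- An acyclic orientation is determined by its outdegrees. -/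
lemma Acyclic.eq_of_outDegree_eq [Finite V(G)] [Finite E(G)] (hO : O.Acyclic)
    (hd : ∀ v, O.outDegree v = O'.outDegree v) : O = O' := by
  have := Fintype.ofFinite V(G)
  have := Fintype.ofFinite E(G)
  obtain ⟨h, hh⟩ := hO.exists_rank
  -- The sum of the ranks of the tails depends only on outdegrees, and `O` maximizes it edge by
  -- edge, so equal sums force equal tails.
  have hsum : ∑ e, h (O'.tail e) = ∑ e, h (O.tail e) := by
    simp only [sum_comp_tail, hd]
  have hle : ∀ e ∈ Finset.univ, h (O'.tail e) ≤ h (O.tail e) := by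
    intro e _
    rcases O'.eq_or_swap e (O.isLink e) with ⟨h', -⟩ | ⟨h', -⟩ <;> rw [h']
    exact (hh e).le
  have heq := (Finset.sum_eq_sum_iff_of_le hle).1 hsum
  refine eq_of_tail_eq (funext fun e => ?_)
  rcases O'.eq_or_swap e (O.isLink e) with ⟨h', -⟩ | ⟨h', -⟩
  · exact h'.symm
  · have := heq e (Finset.mem_univ _)
    rw [h'] at this
    exact absurd this (hh e).ne

lemma outDegree_eq_zero {v : V(G)} (h : ∀ e, O.tail e ≠ v) : O.outDegree v = 0 := by
  have : {e | O.tail e = v} = ∅ := Set.eq_empty_of_forall_notMem h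
  rw [outDegree, this, Set.ncard_empty]

lemma UniqueSink.outDegree_pos [Finite E(G)] (hO : O.UniqueSink q) {v : V(G)} (hv : v ≠ q) :
    0 < O.outDegree v := by
  obtain ⟨e, he⟩ := hO.exists_tail_eq hv
  exact (Set.ncard_pos (Set.toFinite _)).2 ⟨e, he⟩

/-- At a vertex of least rank in `A`, every outgoing edge leaves `A`, and there is at least one. -/
lemma Acyclic.isParking [Finite V(G)] [Finite E(G)] (hO : O.Acyclic) (hq : O.UniqueSink q) :
    IsParking G q fun v => (O.outDegree v : ℤ) - 1 where
  neg_one_le v := by omega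
  root := by simp [outDegree_eq_zero hq.tail_ne]
  exists_lt A hA hqA := by
    obtain ⟨h, hh⟩ := hO.exists_rank
    obtain ⟨v, hv, hmin⟩ := Set.exists_min_image A h (Set.toFinite A) hA
    have hpos := hq.outDegree_pos (v := v) fun h => hqA (h ▸ hv)
    have hle : O.outDegree v ≤ degOutside G A v := by
      rw [outDegree_eq_ncard_image, degOutside]
      refine Set.ncard_le_ncard ?_ ((Set.toFinite E(G)).subset fun e ⟨w, _, h⟩ => h.edge_mem)
      rintro _ ⟨e, rfl, rfl⟩
      exact ⟨O.head e, fun hw => (hmin _ hw).not_gt (hh e), O.isLink e⟩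
    exact ⟨v, hv, by omega, by omega⟩

end Orientation

/-- Burning the vertices one after the other, each vertex has more edges to burnt vertices than
the value of the parking function when it burns. -/
lemma IsParking.exists_burning_order [Finite V(G)] [Finite E(G)] {g : V(G) → ℤ}
    (hg : IsParking G q g) (n : ℕ) (A : Set V(G)) (hn : A.ncard = n) (hA : q ∉ A) :
    ∃ h : V(G) → ℕ, Set.InjOn h A ∧ ∀ v ∈ A,
      g v < {e : β | ∃ w : V(G), (w ∉ A ∨ h w < h v) ∧ G.IsLink e v w}.ncard := by
  classical
  have hfin : ∀ (P : V(G) → Prop) (v : V(G)),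
      {e : β | ∃ w : V(G), P w ∧ G.IsLink e v w}.Finite :=
    fun P v => (Set.toFinite E(G)).subset fun e ⟨w, _, h⟩ => h.edge_mem
  induction n generalizing A with
  | zero =>
    rw [Set.ncard_eq_zero] at hn
    subst hn
    exact ⟨fun _ => 0, by simp, by simp⟩
  | succ n ih =>
    obtain ⟨v₀, hv₀, -, hlt⟩ :=
      hg.exists_lt A (Set.nonempty_of_ncard_ne_zero (by omega)) hA
    obtain ⟨h, hinj, hh⟩ := ih (A \ {v₀})
      (by rw [Set.ncard_sdiff_singleton_of_mem hv₀]; omega) fun h => hA h.1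
    -- `v₀` burns first, so the others are shifted up by one; their edges to `v₀`, which left `A \
    -- {v₀}`, now lead to a smaller rank.
    refine ⟨fun v => if v = v₀ then 0 else h v + 1, ?_, ?_⟩
    · intro v hv w hw hvw
      by_cases h1 : v = v₀ <;> by_cases h2 : w = v₀ <;> simp only [h1, h2, if_true, if_false] at hvw
      · rw [h1, h2]
      · omega
      · omega
      · exact hinj ⟨hv, h1⟩ ⟨hw, h2⟩ (by omega)
    · intro v hv
      by_cases h1 : v = v₀
      · subst h1
        refine hlt.trans_le ?_
        rw [degOutside]
        refine Nat.cast_le.2 (Set.ncard_le_ncard ?_ (hfin _ _))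
        exact fun e ⟨w, hw, hl⟩ => ⟨w, Or.inl hw, hl⟩
      · refine (hh v ⟨hv, h1⟩).trans_le ?_
        refine Nat.cast_le.2 (Set.ncard_le_ncard ?_ (hfin _ _))
        rintro e ⟨w, hw, hl⟩
        refine ⟨w, ?_, hl⟩
        by_cases h2 : w = v₀
        · right
          simp [h1, h2]
        · simp only [h1, h2, if_false]
          rcases hw with hw | hw
          · exact Or.inl fun h => hw ⟨h, h2⟩
          · exact Or.inr (by omega)

/-- Every parking function lies below one that comes from an acyclic orientation. -/
lemma IsParking.exists_le_outDegree [G.Loopless] [Finite V(G)] [Finite E(G)] {g : V(G) → ℤ}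
    (hg : IsParking G q g) :
    ∃ O : Orientation G, (O.Acyclic ∧ O.UniqueSink q) ∧ ∀ v, g v ≤ O.outDegree v - 1 := by
  classical
  obtain ⟨h, hinj, hh⟩ := hg.exists_burning_order _ {q}ᶜ rfl (by simp)
  -- The root burns before all other vertices, and every edge is then directed towards its earlier
  -- burnt end.
  let r : V(G) → ℕ := fun v => if v = q then 0 else h v + 1
  have hr : Function.Injective r := by
    intro v w hvw
    by_cases h1 : v = q <;> by_cases h2 : w = q <;> simp only [r, h1, h2, if_true, if_false] at hvw
    · rw [h1, h2]
    · omega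
    · omega
    · exact hinj h1 h2 (by omega)
  have key : ∀ e : E(G), ∃ x y : V(G), G.IsLink e x y ∧ r y < r x := by
    intro e
    obtain ⟨x, y, hl⟩ := exists_ends e.2
    rcases lt_or_gt_of_ne (hr.ne fun h' => hl.ne (congrArg Subtype.val h')) with hlt | hlt
    · exact ⟨y, x, hl.symm, hlt⟩
    · exact ⟨x, y, hl, hlt⟩
  choose x y hl hlt using key
  let O : Orientation G := ⟨x, y, hl⟩
  have hdeg : ∀ v ≠ q, g v < O.outDegree v := by
    intro v hv
    refine (hh v hv).trans_le ?_
    rw [O.outDegree_eq_ncard_image]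
    refine Nat.cast_le.2 (Set.ncard_le_ncard ?_ ((Set.toFinite E(G)).subset ?_))
    · rintro e ⟨w, hw, hel⟩
      refine ⟨⟨e, hel.edge_mem⟩, ?_, rfl⟩
      have hwv : r w < r v := by
        by_cases h2 : w = q
        · simp [r, h2, hv]
        · simp only [r, h2, hv, if_false]
          rcases hw with hw | hw
          · exact absurd h2 hw
          · omega
      rcases O.eq_or_swap ⟨e, hel.edge_mem⟩ hel with ⟨h1, -⟩ | ⟨h1, h2⟩
      · exact h1
      · have := hlt ⟨e, hel.edge_mem⟩
        change r (O.head _) < r (O.tail _) at this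
        rw [h1, h2] at this
        omega
    · rintro _ ⟨e, -, rfl⟩
      exact e.2
  have hq : ∀ e, O.tail e ≠ q := by
    intro e he
    have := hlt e
    change r (O.head _) < r (O.tail _) at this
    rw [he] at this
    simp [r] at this
  refine ⟨O, ⟨Orientation.acyclic_of_rank r hlt, fun v => ⟨fun hv => ?_, ?_⟩⟩, fun v => ?_⟩
  · by_contra hvq
    -- The parking condition on a singleton gives `0 ≤ g v`, so `v` has positive outdegree.
    obtain ⟨x, hx, h0, -⟩ := hg.exists_lt {v} ⟨v, rfl⟩ (fun h => hvq h.symm)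
    rw [Set.mem_singleton_iff.1 hx] at h0
    have := hdeg _ hvq
    have := Orientation.outDegree_eq_zero hv
    omega
  · rintro rfl
    exact hq
  · by_cases hv : v = q
    · rw [hv, hg.root]
      omega
    · have := hdeg v hv
      omega

/-- A larger parking function lies below the function of another orientation. The outdegrees of
every orientation sum to the number of edges, so the pointwise inequality of outdegrees is an
equality. -/
lemma Orientation.Acyclic.isMaximalParking [G.Loopless] [Finite V(G)] [Finite E(G)]
    (hO : O.Acyclic) (hq : O.UniqueSink q) :
    IsMaximalParking G q fun v => (O.outDegree v : ℤ) - 1 := by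
  refine ⟨hO.isParking hq, fun g hg hle => ?_⟩
  have := Fintype.ofFinite V(G)
  have := Fintype.ofFinite E(G)
  obtain ⟨O', -, hO'⟩ := hg.exists_le_outDegree
  have hle' : ∀ v ∈ Finset.univ, O.outDegree v ≤ O'.outDegree v := by
    intro v _
    have h1 := hle v
    have h2 := hO' v
    simp only at h1
    omega
  have hsum : ∑ v, O.outDegree v = ∑ v, O'.outDegree v := by
    have h1 := O.sum_comp_tail fun _ => 1
    have h2 := O'.sum_comp_tail fun _ => 1
    simp only [mul_one] at h1 h2
    rw [← h1, ← h2]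
  have heq := (Finset.sum_eq_sum_iff_of_le hle').1 hsum
  intro v
  beta_reduce
  rw [heq v (Finset.mem_univ v)]
  exact hO' v

lemma IsMaximalParking.exists_outDegree [G.Loopless] [Finite V(G)] [Finite E(G)] {g : V(G) → ℤ}
    (hg : IsMaximalParking G q g) :
    ∃ O : Orientation G, (O.Acyclic ∧ O.UniqueSink q) ∧ ∀ v, g v = O.outDegree v - 1 := by
  obtain ⟨O, hO, hle⟩ := hg.prop.exists_le_outDegree
  exact ⟨O, hO, fun v => (hle v).antisymm (hg.2 (hO.1.isParking hO.2) hle v)⟩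

end Parking

end GParking

namespace GParking

open scoped Graph

/-! ### Deletion and contraction; extending the bijection -/

section Counting

variable {α β : Type*} {G : Graph α β} {B : Set V(G)} {S : Set β} {e : β} {u v : V(G)}

/-- The edges in `S` from `v` to a vertex outside `A`. -/
def outEdges (G : Graph α β) (S : Set β) (A : Set V(G)) (v : V(G)) : Set β :=
  {e | e ∈ S ∧ ∃ w : V(G), w ∉ A ∧ G.IsLink e v w}

/-- The parking functions of the multigraph with edges `S` and with the vertices in `B` merged
into the root. -/
def parkingSet (G : Graph α β) (B : Set V(G)) (S : Set β) : Set (V(G) → ℤ) :=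
  {g | (∀ v ∈ B, g v = -1) ∧ ∀ A : Set V(G), A.Nonempty → (∀ v ∈ A, v ∉ B) →
    ∃ v ∈ A, 0 ≤ g v ∧ g v < (outEdges G S A v).ncard}

/-- The spanning trees of the multigraph with edges `S` and with the vertices in `B` merged
into the root. -/
def treeSet (G : Graph α β) (B : Set V(G)) (S : Set β) : Set (Set β) :=
  {T | T ⊆ S ∧ T.ncard = Bᶜ.ncard ∧ ∀ A : Set V(G), A.Nonempty → (∀ v ∈ A, v ∉ B) →
    ∃ e ∈ T, ∃ v ∈ A, ∃ w ∉ A, G.IsLink e v w}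

lemma outEdges_sdiff_of_ne (he : G.IsLink e u v) (hu : u ∈ B) {A : Set V(G)}
    (hA : ∀ v ∈ A, v ∉ B) {x : V(G)} (hx : x ∈ A) (hxv : x ≠ v) :
    outEdges G (S \ {e}) A x = outEdges G S A x := by
  ext f
  refine ⟨fun ⟨h, w⟩ => ⟨h.1, w⟩, fun ⟨h, w, hw, hl⟩ => ⟨⟨h, ?_⟩, w, hw, hl⟩⟩
  rintro rfl
  rcases hl.eq_and_eq_or_eq_and_eq he with ⟨h, -⟩ | ⟨h, -⟩
  · exact hA x hx (Subtype.ext h ▸ hu)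
  · exact hxv (Subtype.ext h)

lemma ncard_outEdges_sdiff (he : G.IsLink e u v) (heS : e ∈ S) (hS : S.Finite) (hu : u ∈ B)
    {A : Set V(G)} (hA : ∀ v ∈ A, v ∉ B) :
    (outEdges G S A v).ncard = (outEdges G (S \ {e}) A v).ncard + 1 := by
  have hfin : (outEdges G (S \ {e}) A v).Finite := hS.subset fun f hf => hf.1.1
  have hmem : e ∉ outEdges G (S \ {e}) A v := fun h => h.1.2 rfl
  rw [← Set.ncard_insert_of_notMem hmem hfin]
  congr 1
  ext f
  simp only [outEdges, Set.mem_ofPred_eq, Set.mem_insert_iff, Set.mem_sdiff, Set.mem_singleton_iff]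
  constructor
  · rintro ⟨hf, h⟩
    by_cases hfe : f = e
    · exact Or.inl hfe
    · exact Or.inr ⟨⟨hf, hfe⟩, h⟩
  · rintro (rfl | ⟨⟨hf, -⟩, h⟩)
    · exact ⟨heS, u, fun h => hA u h hu, he.symm⟩
    · exact ⟨hf, h⟩

/-- Deleting `e` lowers only the count at `v`, by one. If `g v > 0`, this is matched by lowering `g
v`; if `g v = 0`, then `v` meets its bound in any set containing it, thanks to `e`, and can be
merged into the root. -/
lemma parkingSet_eq_union [DecidableEq V(G)] (he : G.IsLink e u v) (heS : e ∈ S)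
    (hS : S.Finite) (hu : u ∈ B) (hv : v ∉ B) :
    parkingSet G B S = (fun g => g + Pi.single v 1) '' parkingSet G B (S \ {e}) ∪
      (fun g => Function.update g v 0) '' parkingSet G (insert v B) (S \ {e}) := by
  ext g
  constructor
  · rintro ⟨hB, hg⟩
    obtain ⟨x, hx, h0, -⟩ := hg {v} ⟨v, rfl⟩ (by simpa using hv)
    rw [Set.mem_singleton_iff.1 hx] at h0
    by_cases hgv : g v = 0
    · right
      refine ⟨Function.update g v (-1), ⟨?_, fun A hA hAB => ?_⟩, ?_⟩
      · intro w hw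
        by_cases hwv : w = v
        · simp [hwv]
        · simpa [hwv] using hB w (hw.resolve_left hwv)
      · obtain ⟨x, hx, h1, h2⟩ := hg A hA fun w hw h => hAB w hw (Or.inr h)
        have hxv : x ≠ v := fun h => hAB x hx (Or.inl h)
        refine ⟨x, hx, ?_⟩
        rw [outEdges_sdiff_of_ne he hu (fun w hw h => hAB w hw (Or.inr h)) hx hxv]
        simp [hxv, h1, h2]
      · simp [← hgv]
    · left
      refine ⟨g - Pi.single v 1, ⟨?_, fun A hA hAB => ?_⟩, by simp⟩
      · intro w hw
        have hwv : w ≠ v := fun h => hv (h ▸ hw)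
        simp [hwv, hB w hw]
      · obtain ⟨x, hx, h1, h2⟩ := hg A hA hAB
        refine ⟨x, hx, ?_⟩
        by_cases hxv : x = v
        · subst hxv
          rw [ncard_outEdges_sdiff he heS hS hu hAB] at h2
          simp only [Pi.sub_apply, Pi.single_eq_same]
          push_cast at h2
          omega
        · rw [outEdges_sdiff_of_ne he hu hAB hx hxv]
          simp [hxv, h1, h2]
  · rintro (⟨g, ⟨hB, hg⟩, rfl⟩ | ⟨g, ⟨hB, hg⟩, rfl⟩)
    · refine ⟨?_, fun A hA hAB => ?_⟩
      · intro w hw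
        have hwv : w ≠ v := fun h => hv (h ▸ hw)
        simp [hwv, hB w hw]
      · obtain ⟨x, hx, h1, h2⟩ := hg A hA hAB
        refine ⟨x, hx, ?_⟩
        by_cases hxv : x = v
        · subst hxv
          rw [ncard_outEdges_sdiff he heS hS hu hAB]
          simp only [Pi.add_apply, Pi.single_eq_same]
          push_cast
          omega
        · rw [outEdges_sdiff_of_ne he hu hAB hx hxv] at h2
          simp [hxv, h1, h2]
    · refine ⟨?_, fun A hA hAB => ?_⟩
      · intro w hw
        have hwv : w ≠ v := fun h => hv (h ▸ hw)
        simpa [hwv] using hB w (Or.inr hw)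
      · by_cases hvA : v ∈ A
        · refine ⟨v, hvA, by simp, ?_⟩
          rw [ncard_outEdges_sdiff he heS hS hu hAB]
          simp only [Function.update_self]
          positivity
        · obtain ⟨x, hx, h1, h2⟩ := hg A hA (by
            rintro w hw (rfl | h)
            · exact hvA hw
            · exact hAB w hw h)
          have hxv : x ≠ v := fun h => hvA (h ▸ hx)
          rw [outEdges_sdiff_of_ne he hu hAB hx hxv] at h2
          exact ⟨x, hx, by simp [hxv, h1, h2]⟩

/-- The trees avoiding `e` are those of the deletion; those containing `e` come from the
contraction, where one vertex fewer has to be attached. -/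
lemma treeSet_eq_union [Finite V(G)] (he : G.IsLink e u v) (heS : e ∈ S)
    (hS : S.Finite) (hu : u ∈ B) (hv : v ∉ B) :
    treeSet G B S = treeSet G B (S \ {e}) ∪
      insert e '' treeSet G (insert v B) (S \ {e}) := by
  have hcard : Bᶜ.ncard = (insert v B)ᶜ.ncard + 1 := by
    have : (insert v B)ᶜ = Bᶜ \ {v} := by
      ext w
      simp [and_comm]
    rw [this, Set.ncard_sdiff_singleton_add_one hv]
  ext T
  constructor
  · rintro ⟨hTS, hT, hcut⟩
    by_cases heT : e ∈ T
    · right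
      refine ⟨T \ {e}, ⟨Set.sdiff_subset_sdiff_left hTS, ?_, fun A hA hAB => ?_⟩, by simp [heT]⟩
      · have := Set.ncard_sdiff_singleton_add_one heT (hS.subset hTS)
        omega
      · obtain ⟨f, hf, x, hx, w, hw, hl⟩ := hcut A hA fun w hw h => hAB w hw (Or.inr h)
        refine ⟨f, ⟨hf, ?_⟩, x, hx, w, hw, hl⟩
        rintro rfl
        rcases hl.eq_and_eq_or_eq_and_eq he with ⟨h, -⟩ | ⟨h, -⟩
        · exact hAB x hx (Or.inr (Subtype.ext h ▸ hu))
        · exact hAB x hx (Or.inl (Subtype.ext h))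
    · exact Or.inl ⟨fun f hf => ⟨hTS hf, fun h => heT (h ▸ hf)⟩, hT, hcut⟩
  · rintro (⟨hTS, hT, hcut⟩ | ⟨T, ⟨hTS, hT, hcut⟩, rfl⟩)
    · exact ⟨hTS.trans Set.sdiff_subset, hT, hcut⟩
    · refine ⟨Set.insert_subset heS (hTS.trans Set.sdiff_subset), ?_, fun A hA hAB => ?_⟩
      · rw [Set.ncard_insert_of_notMem (fun h => (hTS h).2 rfl) (hS.subset
          (hTS.trans Set.sdiff_subset)), hT, hcard]
      · by_cases hvA : v ∈ A
        · exact ⟨e, Or.inl rfl, v, hvA, u, fun h => hAB u h hu, he.symm⟩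
        · obtain ⟨f, hf, h⟩ := hcut A hA (by
            rintro w hw (rfl | h)
            · exact hvA hw
            · exact hAB w hw h)
          exact ⟨f, Or.inr hf, h⟩

/-- There are as many parking functions as spanning trees, by deletion and contraction. -/
lemma encard_parkingSet [Finite V(G)] (n : ℕ) (B : Set V(G)) (S : Set β) (hS : S.Finite)
    (hn : S.ncard = n) : (parkingSet G B S).encard = (treeSet G B S).encard := by
  classical
  induction n using Nat.strong_induction_on generalizing B S with
  | _ n ih =>
    by_cases hex : ∃ e ∈ S, ∃ u ∈ B, ∃ v ∉ B, G.IsLink e u v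
    · obtain ⟨e, heS, u, hu, v, hv, he⟩ := hex
      have hlt : (S \ {e}).ncard < n := hn ▸ Set.ncard_sdiff_singleton_lt_of_mem heS hS
      have hfin : (S \ {e}).Finite := hS.subset Set.sdiff_subset
      rw [parkingSet_eq_union he heS hS hu hv, treeSet_eq_union he heS hS hu hv,
        Set.encard_union_eq, Set.encard_union_eq, ih _ hlt B _ hfin rfl |>.symm,
        Set.InjOn.encard_image, Set.InjOn.encard_image, Set.InjOn.encard_image,
        ih _ hlt (insert v B) _ hfin rfl]
      · intro T hT T' hT' h
        have h1 : e ∉ T := fun h => (hT.1 h).2 rfl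
        have h2 : e ∉ T' := fun h => (hT'.1 h).2 rfl
        rw [← Set.insert_sdiff_self_of_notMem h1, ← Set.insert_sdiff_self_of_notMem h2]
        rw [h]
      · intro g hg g' hg' h
        funext w
        by_cases hw : w = v
        · rw [hw, hg.1 v (Or.inl rfl), hg'.1 v (Or.inl rfl)]
        · simpa [hw] using congrFun h w
      · exact (add_left_injective _).injOn
      · rw [Set.disjoint_left]
        rintro _ hT ⟨T, -, rfl⟩
        exact (hT.1 (Set.mem_insert e T)).2 rfl
      -- At `v` the functions from the deletion are at least 1, those from the contraction are 0.
      · rw [Set.disjoint_left]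
        rintro _ ⟨g, hg, rfl⟩ ⟨g', -, h⟩
        obtain ⟨x, hx, h0, -⟩ := hg.2 {v} ⟨v, rfl⟩ (by simpa using hv)
        rw [Set.mem_singleton_iff.1 hx] at h0
        have := congrFun h v
        simp at this
        omega
    -- No edge joins `B` to its complement: either nothing is left to attach and both sets are
    -- singletons, or the cut at `Bᶜ` makes both empty.
    · by_cases hB : B = Set.univ
      · subst hB
        have hp : parkingSet G Set.univ S = {fun _ => -1} := by
          ext g
          refine ⟨fun hg => funext fun v => hg.1 v trivial, ?_⟩
          rintro rfl
          exact ⟨fun _ _ => rfl, fun A ⟨a, ha⟩ hA => absurd trivial (hA a ha)⟩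
        have ht : treeSet G Set.univ S = {∅} := by
          ext T
          refine ⟨fun hT => ?_, ?_⟩
          · have := hT.2.1
            rw [Set.compl_univ, Set.ncard_empty, Set.ncard_eq_zero (hS.subset hT.1)] at this
            exact this
          · rintro rfl
            exact ⟨Set.empty_subset _, by simp,
              fun A ⟨a, ha⟩ hA => absurd trivial (hA a ha)⟩
        rw [hp, ht, Set.encard_singleton, Set.encard_singleton]
      · have hne : Bᶜ.Nonempty := Set.nonempty_compl.2 hB
        have hp : parkingSet G B S = ∅ := by
          refine Set.eq_empty_of_forall_notMem fun g hg => ?_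
          obtain ⟨v, hv, h0, hlt⟩ := hg.2 Bᶜ hne fun _ h => h
          have : outEdges G S Bᶜ v = ∅ := by
            refine Set.eq_empty_of_forall_notMem fun e ⟨he, w, hw, hl⟩ => hex ?_
            exact ⟨e, he, w, not_not.1 hw, v, hv, hl.symm⟩
          rw [this, Set.ncard_empty] at hlt
          omega
        have ht : treeSet G B S = ∅ := by
          refine Set.eq_empty_of_forall_notMem fun T hT => ?_
          obtain ⟨e, he, v, hv, w, hw, hl⟩ := hT.2.2 Bᶜ hne fun _ h => h
          exact hex ⟨e, hT.1 he, w, not_not.1 hw, v, hv, hl.symm⟩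
        rw [hp, ht, Set.encard_empty, Set.encard_empty]

lemma mem_parkingSet_iff [Finite V(G)] {q : V(G)} {g : V(G) → ℤ} :
    g ∈ parkingSet G {q} E(G) ↔ IsParking G q g := by
  have hout : ∀ A v, (outEdges G E(G) A v).ncard = degOutside G A v := by
    intro A v
    rw [degOutside, outEdges]
    congr 1
    ext e
    exact ⟨fun h => h.2, fun ⟨w, hw, hl⟩ => ⟨hl.edge_mem, w, hw, hl⟩⟩
  have hA : ∀ A : Set V(G), (∀ v ∈ A, v ∉ ({q} : Set V(G))) ↔ q ∉ A := fun _ =>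
    Set.disjoint_left.symm.trans Set.disjoint_singleton_right
  simp only [parkingSet, hout, hA, Set.mem_ofPred_eq]
  simp only [Set.mem_singleton_iff, forall_eq]
  refine ⟨fun ⟨h1, h2⟩ => ⟨fun v => ?_, h1, h2⟩, fun h => ⟨h.root, h.exists_lt⟩⟩
  by_cases hv : v = q
  · rw [hv, h1]
  · obtain ⟨x, hx, h0, -⟩ := h2 {v} ⟨v, rfl⟩ fun h => hv h.symm
    rw [Set.mem_singleton_iff.1 hx] at h0
    omega

lemma mem_treeSet_iff [G.Loopless] [Finite V(G)] [Finite E(G)] {q : V(G)} {T : Set β} :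
    T ∈ treeSet G {q} E(G) ↔ IsSpanningTree G T := by
  have hA : ∀ A : Set V(G), (∀ v ∈ A, v ∉ ({q} : Set V(G))) ↔ q ∉ A := fun _ =>
    Set.disjoint_left.symm.trans Set.disjoint_singleton_right
  have hc := Set.ncard_add_ncard_compl ({q} : Set V(G))
  rw [Set.ncard_singleton] at hc
  rw [isSpanningTree_iff q]
  simp only [treeSet, hA, Set.mem_ofPred_eq]
  refine and_congr_right fun _ => and_congr_left fun _ => ?_
  omega

lemma nonempty_parking_equiv_spanningTree [G.Loopless] [Finite V(G)] [Finite E(G)] (q : V(G)) :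
    Nonempty ({f : V(G) → ℤ // IsParking G q f} ≃ {T : Set β // IsSpanningTree G T}) := by
  have hfin : Finite {T : Set β // IsSpanningTree G T} :=
    ((Set.toFinite E(G)).finite_subsets.subset fun T (hT : IsSpanningTree G T) => hT.subset)
  have hcard : {f : V(G) → ℤ | IsParking G q f}.encard =
      {T : Set β | IsSpanningTree G T}.encard := by
    have := encard_parkingSet _ {q} E(G) (Set.toFinite _) rfl
    rwa [show parkingSet G {q} E(G) = {f | IsParking G q f} from
        Set.ext fun _ => mem_parkingSet_iff,
      show treeSet G {q} E(G) = {T | IsSpanningTree G T} from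
        Set.ext fun _ => mem_treeSet_iff] at this
  have hfin' : {T : Set β | IsSpanningTree G T}.Finite := hfin
  -- Finiteness of the set of parking functions is inherited from the trees, which is why the count
  -- uses `encard`.
  have hfin₂ : {f : V(G) → ℤ | IsParking G q f}.Finite := by
    rw [← Set.encard_lt_top_iff, hcard]
    exact hfin'.encard_lt_top
  have : Finite {f : V(G) → ℤ // IsParking G q f} := hfin₂
  refine Finite.card_eq.1 ?_
  exact congrArg ENat.toNat hcard

/-- A bijection between two finite types can be chosen to extend a given one between subtypes. -/
lemma exists_equiv_extending {X Y : Type*} [Finite X] (e : X ≃ Y) {p : X → Prop} {r : Y → Prop}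
    (f : {x // p x} ≃ {y // r y}) :
    ∃ g : X ≃ Y, (∀ x, p x ↔ r (g x)) ∧ ∀ x (hx : p x), g x = f ⟨x, hx⟩ := by
  classical
  have := Fintype.ofFinite X
  -- Transporting `f` along `e` turns it into a partial permutation of the finite type `X`, which
  -- extends to a full one.
  let f' : {x // p x} ≃ {x // r (e x)} :=
    f.trans (e.symm.subtypeEquiv fun y => by simp)
  have h1 : ∀ x (hx : p x), e (f'.extendSubtype x) = f ⟨x, hx⟩ := fun x hx => by
    rw [f'.extendSubtype_apply_of_mem x hx]
    simp [f']
  refine ⟨f'.extendSubtype.trans e, fun x => ⟨fun hx => ?_, fun h => ?_⟩, h1⟩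
  · exact f'.extendSubtype_mem x hx
  · by_contra hx
    exact f'.extendSubtype_not_mem x hx h

end Counting

end GParking

/-! ### Assembling `μ` and `π` -/

theorem theorem4p6 {α β : Type*} [LinearOrder β] (G : Graph α β) [G.Loopless]
    [Finite G.vertexSet] [Finite G.edgeSet] (hG : GParking.Connected G) (q : G.vertexSet) :
    ∃ μ : {T : Set β // GParking.IsSafe G T} →
        {O : GParking.Orientation G // O.Acyclic ∧ O.UniqueSink q},
      (Function.Bijective μ ∧ ∀ T, (μ T).1.InducedBy T.1 q) ∧
      ∃ π : {f : G.vertexSet → ℤ // GParking.IsParking G q f} →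
          {T : Set β // GParking.IsSpanningTree G T},
        Function.Bijective π ∧
        (∀ f, GParking.IsMaximalParking G q f.1 ↔ GParking.IsSafe G (π f).1) ∧
        (∀ f, ∀ hs : GParking.IsSafe G (π f).1, ∀ v,
          f.1 v = ((μ ⟨(π f).1, hs⟩).1.outDegree v : ℤ) - 1) := by
  choose O hO using fun T : {T : Set β // GParking.IsSafe G T} => T.2.1.exists_inducedBy q
  let μ : {T : Set β // GParking.IsSafe G T} →
      {O : GParking.Orientation G // O.Acyclic ∧ O.UniqueSink q} :=
    fun T => ⟨O T, (hO T).acyclic, (hO T).uniqueSink T.2.1⟩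
  have hμ : Function.Bijective μ := by
    constructor
    · intro T T' h
      have h' : O T = O T' := congrArg Subtype.val h
      exact Subtype.ext ((hO T).eq_of_isSafe T.2 T'.2 (h' ▸ hO T'))
    · rintro ⟨O', hac, hq⟩
      obtain ⟨T, hT, hind⟩ := hac.exists_isSafe hq
      exact ⟨⟨T, hT⟩, Subtype.ext ((hO ⟨T, hT⟩).unique hind)⟩
  obtain ⟨e⟩ := GParking.nonempty_parking_equiv_spanningTree (G := G) q
  -- The inverse of `ν` is the prescribed part of `π`, on maximal parking functions; off them `π` is
  -- an arbitrary bijection onto the unsafe trees.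
  let ν : {T : {T : Set β // GParking.IsSpanningTree G T} // GParking.IsSafe G T.1} →
      {f : {f : G.vertexSet → ℤ // GParking.IsParking G q f} //
        GParking.IsMaximalParking G q f.1} :=
    fun T => ⟨⟨fun v => ((μ ⟨T.1.1, T.2⟩).1.outDegree v : ℤ) - 1, (μ _).2.1.isParking (μ _).2.2⟩,
      (μ _).2.1.isMaximalParking (μ _).2.2⟩
  have hν : Function.Bijective ν := by
    constructor
    · intro T T' h
      have h' := congrArg (fun f => f.1.1) h
      have hT : μ ⟨T.1.1, T.2⟩ = μ ⟨T'.1.1, T'.2⟩ :=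
        Subtype.ext ((μ _).2.1.eq_of_outDegree_eq fun v => by
          have := congrFun h' v
          simp only [ν] at this
          omega)
      exact Subtype.ext (Subtype.ext (Subtype.mk.inj (hμ.1 hT)))
    · rintro ⟨⟨f, hf⟩, hmax⟩
      obtain ⟨O', hO', hf'⟩ := GParking.IsMaximalParking.exists_outDegree hmax
      obtain ⟨T, hT⟩ := hμ.2 ⟨O', hO'⟩
      refine ⟨⟨⟨T.1, T.2.1⟩, T.2⟩, Subtype.ext (Subtype.ext (funext fun v => ?_))⟩
      simp only [ν]
      rw [hT]
      exact (hf' v).symm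
  have : Finite {T : Set β // GParking.IsSpanningTree G T} :=
    ((Set.toFinite G.edgeSet).finite_subsets.subset
      fun T (hT : GParking.IsSpanningTree G T) => hT.subset)
  have := Finite.of_equiv _ e.symm
  obtain ⟨π, hπ, hπ'⟩ := GParking.exists_equiv_extending e (Equiv.ofBijective ν hν).symm
  refine ⟨μ, ⟨hμ, hO⟩, π, π.bijective, hπ, fun f hs v => ?_⟩
  have hmax := (hπ f).2 hs
  have h1 : ν ⟨π f, hs⟩ = ⟨f, hmax⟩ := by
    have h2 : (⟨π f, hs⟩ : {T : {T : Set β // GParking.IsSpanningTree G T} //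
        GParking.IsSafe G T.1}) = (Equiv.ofBijective ν hν).symm ⟨f, hmax⟩ :=
      Subtype.ext (hπ' f hmax)
    rw [h2]
    exact (Equiv.ofBijective ν hν).apply_symm_apply _
  exact (congrFun (congrArg (fun f => f.1.1) h1) v).symm
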